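/- Let $n\ge 0$ and $0\le i\le n$ be integers. The hypercube $H(n)$ has vertex set $\mathbb{Z}_2^n$, two vertices being adjacent when they differ in exactly one coordinate. Let $U_i(n)$ be the space of functions $f:\mathbb{Z}_2^n\to\mathbb{R}$ such that $(n-2i)\,f(x)=\sum_{y\sim x}f(y)$ for every $x\in\mathbb{Z}_2^n$, the sum being over the neighbours $y$ of $x$ in $H(n)$. Write $|f|$ for the number of $x$ with $f(x)\neq 0$. Two functions $f,g:\mathbb{Z}_2^n\to\mathbb{R}$ are equivalent if there are an automorphism $\pi$ of the graph $H(n)$ and a real $c\neq 0$ with $g(x)=c\,f(\pi(x))$ for all $x$. For $f_1:\mathbb{Z}_2^{m}\to\mathbb{R}$ and $f_2:\mathbb{Z}_2^{k}\to\mathbb{R}$, the tensor product $f_1\otimes f_2:\mathbb{Z}_2^{m+k}\to\mathbb{R}$ is $(f_1\otimes f_2)(x,y)=f_1(x)f_2(y)$, and $f_1^{\otimes r}$ is the tensor product of $r$ copies of $f_1$ (for $r=0$, the constant $1$ on $\mathbb{Z}_2^0$). For $k\ge 1$, the functions $\varphi_k,\psi_k:\mathbb{Z}_2^k\to\mathbb{R}$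 vanish except at the all-zeros vector $\mathbf 0$ and the all-ones vector $\mathbf 1$, where $\varphi_k(\mathbf 0)=1$, $\varphi_k(\mathbf 1)=-1$ and $\psi_k(\mathbf 0)=\psi_k(\mathbf 1)=1$. Let $f\in U_i(n)$. 1. If $i\ge \frac n2$, then $|f|=2^i$ if and only if $f$ is equivalent to $\varphi_1^{\otimes(2i-n)}\otimes\varphi_2^{\otimes(n-i)}$. 2. If $i\le \frac n2$, then $|f|=2^{n-i}$ if and only if $f$ is equivalent to $\psi_1^{\otimes(n-2i)}\otimes\varphi_2^{\otimes i}$. -/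

import Mathlib

/-- The `n`-dimensional hypercube `H(n)`: its vertices are the vectors of `ℤ₂ⁿ`, and two vertices are
adjacent when they differ in exactly one coordinate. -/
def hypercube (n : ℕ) : SimpleGraph (Fin n → ZMod 2) where
  Adj x y := hammingDist x y = 1
  symm := ⟨fun x y h => by rw [hammingDist_comm]; exact h⟩
  loopless := ⟨fun x h => by simp at h⟩

instance hypercube.decidableAdj (n : ℕ) : DecidableRel (hypercube n).Adj :=
  fun x y => inferInstanceAs (Decidable (hammingDist x y = 1))

/-- `U_i(n)`: the eigenspace of (the adjacency matrix of) `H(n)` for the value `n - 2i`. -/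
noncomputable def hypercubeEigenspace (n i : ℕ) : Submodule ℝ ((Fin n → ZMod 2) → ℝ) :=
  Module.End.eigenspace (Matrix.toLin' ((hypercube n).adjMatrix ℝ)) ((n : ℝ) - 2 * (i : ℝ))

/-- Membership in `U_i(n)` spelled out: `(n - 2i) f(x) = ∑_{y ∈ N(x)} f(y)` for every vertex `x`. -/
theorem mem_hypercubeEigenspace_iff (n i : ℕ) (f : (Fin n → ZMod 2) → ℝ) :
    f ∈ hypercubeEigenspace n i ↔
      ∀ x, ((n : ℝ) - 2 * (i : ℝ)) * f x = ∑ y ∈ (hypercube n).neighborFinset x, f y := by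
  simp [hypercubeEigenspace, funext_iff,
    SimpleGraph.adjMatrix_mulVec_apply, eq_comm]

/-- Two functions `f, g` on the vertices of `H(n)` are equivalent if `g(x) = c · f(π(x))` for some
automorphism `π` of `H(n)` and some nonzero real `c`. -/
def HypercubeEquivalent {n : ℕ} (f g : (Fin n → ZMod 2) → ℝ) : Prop :=
  ∃ π : hypercube n ≃g hypercube n, ∃ c : ℝ, c ≠ 0 ∧ ∀ x, g x = c * f (π x)

/-- `φ_k`: `1` at the all-zeros vector, `-1` at the all-ones vector, `0` elsewhere (used for `k ≥ 1`). -/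
def phiFun (k : ℕ) : (Fin k → ZMod 2) → ℝ :=
  fun x => if x = 0 then 1 else if x = 1 then -1 else 0

/-- `ψ_k`: `1` at the all-zeros vector and at the all-ones vector, `0` elsewhere (used for `k ≥ 1`). -/
def psiFun (k : ℕ) : (Fin k → ZMod 2) → ℝ :=
  fun x => if x = 0 then 1 else if x = 1 then 1 else 0

/-- The tensor product `(f ⊗ g)(x, y) = f(x) g(y)`, where `H(m) □ H(n)` is identified with `H(m+n)` by
concatenating vectors. -/
def tensorFun {m n : ℕ} (f : (Fin m → ZMod 2) → ℝ) (g : (Fin n → ZMod 2) → ℝ) :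
    (Fin (m + n) → ZMod 2) → ℝ :=
  fun z => f (fun a => z (Fin.castAdd n a)) * g (fun b => z (Fin.natAdd m b))

/-- The tensor power `f ⊗ ⋯ ⊗ f` (`k` factors), on the vertices of `H(m k)`; for `k = 0` it is the
constant `1` on the single vertex of `H(0)`. -/
def tensorPow {m : ℕ} (f : (Fin m → ZMod 2) → ℝ) : (k : ℕ) → (Fin (m * k) → ZMod 2) → ℝ
  | 0 => fun _ => 1
  | k + 1 => tensorFun (tensorPow f k) f

/-- A function on `H(m)` read as a function on `H(n)` when `m = n`. -/
def castDim {m n : ℕ} (h : m = n) (f : (Fin m → ZMod 2) → ℝ) : (Fin n → ZMod 2) → ℝ :=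
  fun x => f (fun a => x (Fin.cast h a))

/-! Cut the cube along a coordinate `r`. The difference of the two slices is an eigenfunction for `μ
+ 1`; if the slices agree, each is one for `μ - 1`. Induction on `n` gives the bound `2 ^ (n - i)`
on the support of a nonzero eigenfunction. Multiplication by the parity character negates the
eigenvalue and keeps the support, which exchanges `i` with `n - i`: this yields the bound `2 ^ i`
and reduces the case `n ≤ 2 * i` to `2 * i ≤ n`.

Let the bound `2 ^ (n - i)` be attained. A coordinate with equal slices can be dropped. If there is
none, the bound applied to the slice differences forces the slices to have disjoint supports in
every direction, so the support is independent and the eigenvalue is `0`. The slice difference then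
has minimum support and nonzero eigenvalue, so it is symmetric in some coordinate `s`. On the four
slices along `0` and `s` this forces opposite signs at opposite corners, and the bound leaves only
one opposite pair nonzero: a factor `φ₂` splits off (`isPhiTwoProduct_of_ncard_support`). -/

/-- `f` satisfies the eigenvalue equation for `μ`, the neighbours of `x` being written `x + e_j`. -/
def IsCubeEigen (n : ℕ) (μ : ℝ) (f : (Fin n → ZMod 2) → ℝ) : Prop :=
  ∀ x, μ * f x = ∑ j, f (x + Pi.single j 1)

theorem zmod_two_eq (a : ZMod 2) : a = 0 ∨ a = 1 := by
  revert a
  decide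

theorem hammingDist_eq_one_iff {n : ℕ} (x y : Fin n → ZMod 2) :
    hammingDist x y = 1 ↔ ∃ j, x + Pi.single j 1 = y := by
  constructor
  · intro h
    obtain ⟨j, hj⟩ := Finset.card_eq_one.1 h
    refine ⟨j, funext fun k => ?_⟩
    have hk : x k ≠ y k ↔ k = j := by
      have := Finset.ext_iff.1 hj k
      simpa using this
    by_cases hkj : k = j
    · subst hkj
      have h1 := hk.2 rfl
      simp only [Pi.add_apply, Pi.single_eq_same]
      revert h1
      generalize x k = a
      generalize y k = b
      revert a b
      decide
    · simp only [Pi.add_apply, Pi.single_eq_of_ne hkj, add_zero]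
      exact not_not.1 fun h => hkj (hk.1 h)
  · rintro ⟨j, rfl⟩
    refine Finset.card_eq_one.2 ⟨j, ?_⟩
    ext k
    by_cases hkj : k = j
    · subst hkj; simp
    · simp [hkj]

theorem mem_hypercubeEigenspace_iff_isCubeEigen (n i : ℕ) (f : (Fin n → ZMod 2) → ℝ) :
    f ∈ hypercubeEigenspace n i ↔ IsCubeEigen n ((n : ℝ) - 2 * i) f := by
  rw [mem_hypercubeEigenspace_iff]
  refine forall_congr' fun x => ?_
  have h : (hypercube n).neighborFinset x
      = Finset.univ.image fun j => x + Pi.single j (1 : ZMod 2) := by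
    ext y
    simp only [SimpleGraph.mem_neighborFinset, Finset.mem_image, Finset.mem_univ, true_and]
    exact hammingDist_eq_one_iff x y
  rw [h, Finset.sum_image]
  intro j _ k _ hjk
  have := congrFun (add_left_cancel hjk) j
  by_contra hne
  simp [Pi.single_eq_of_ne hne] at this

/-! ### Slices along a coordinate -/

theorem insertNth_add_single_self {n : ℕ} (r : Fin (n + 1)) (a : ZMod 2) (x : Fin n → ZMod 2) :
    (r.insertNth a x : Fin (n + 1) → ZMod 2) + Pi.single r 1 = r.insertNth (a + 1) x := by
  funext k
  refine Fin.succAboveCases r ?_ (fun k => ?_) k <;> simp [Fin.succAbove_ne]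

theorem insertNth_add_single_succAbove {n : ℕ} (r : Fin (n + 1)) (a : ZMod 2)
    (x : Fin n → ZMod 2) (j : Fin n) :
    (r.insertNth a x : Fin (n + 1) → ZMod 2) + Pi.single (r.succAbove j) 1
      = r.insertNth a (x + Pi.single j 1) := by
  funext k
  refine Fin.succAboveCases r ?_ (fun k => ?_) k
  · simp [(Fin.succAbove_ne r j).symm]
  · simp [Pi.single_apply]

/-- The restriction of `f` to the subcube on which the coordinate `r` equals `a`. -/
def cubeSlice {n : ℕ} (r : Fin (n + 1)) (a : ZMod 2) (f : (Fin (n + 1) → ZMod 2) → ℝ) :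
    (Fin n → ZMod 2) → ℝ :=
  fun x => f (r.insertNth a x)

theorem IsCubeEigen.slice {n : ℕ} {μ : ℝ} {f : (Fin (n + 1) → ZMod 2) → ℝ}
    (hf : IsCubeEigen (n + 1) μ f) (r : Fin (n + 1)) (a : ZMod 2) (x : Fin n → ZMod 2) :
    μ * cubeSlice r a f x
      = cubeSlice r (a + 1) f x + ∑ j, cubeSlice r a f (x + Pi.single j 1) := by
  have h := hf (r.insertNth a x)
  rw [Fin.sum_univ_succAbove _ r, insertNth_add_single_self] at h
  simpa only [cubeSlice, insertNth_add_single_succAbove] using h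

theorem IsCubeEigen.slice_slice {n : ℕ} {μ : ℝ} {f : (Fin (n + 2) → ZMod 2) → ℝ}
    (hf : IsCubeEigen (n + 2) μ f) (r : Fin (n + 2)) (s : Fin (n + 1)) (a b : ZMod 2)
    (x : Fin n → ZMod 2) :
    μ * cubeSlice s b (cubeSlice r a f) x
      = cubeSlice s b (cubeSlice r (a + 1) f) x + (cubeSlice s (b + 1) (cubeSlice r a f) x
        + ∑ j, cubeSlice s b (cubeSlice r a f) (x + Pi.single j 1)) := by
  have h := hf.slice r a (s.insertNth b x)
  rw [Fin.sum_univ_succAbove _ s, insertNth_add_single_self] at h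
  simp only [insertNth_add_single_succAbove] at h
  exact h

/-- The edges in direction `r` contribute minus the difference itself; moving that term to the left
raises `μ` by one. -/
theorem IsCubeEigen.slice_sub {n : ℕ} {μ : ℝ} {f : (Fin (n + 1) → ZMod 2) → ℝ}
    (hf : IsCubeEigen (n + 1) μ f) (r : Fin (n + 1)) :
    IsCubeEigen n (μ + 1) (cubeSlice r 0 f - cubeSlice r 1 f) := by
  intro x
  have h0 := hf.slice r 0 x
  have h1 := hf.slice r 1 x
  rw [show (0 : ZMod 2) + 1 = 1 from rfl] at h0
  rw [show (1 : ZMod 2) + 1 = 0 from rfl] at h1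
  simp only [Pi.sub_apply, Finset.sum_sub_distrib]
  linarith

theorem IsCubeEigen.slice_of_eq {n : ℕ} {μ : ℝ} {f : (Fin (n + 1) → ZMod 2) → ℝ}
    (hf : IsCubeEigen (n + 1) μ f) (r : Fin (n + 1)) (h : cubeSlice r 0 f = cubeSlice r 1 f) :
    IsCubeEigen n (μ - 1) (cubeSlice r 0 f) := by
  intro x
  have h0 := hf.slice r 0 x
  rw [show (0 : ZMod 2) + 1 = 1 from rfl, ← h] at h0
  linarith

theorem exists_insertNth {n : ℕ} (r : Fin (n + 1)) (y : Fin (n + 1) → ZMod 2) :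
    ∃ a x, y = r.insertNth a x :=
  ⟨y r, r.removeNth y, (Fin.insertNth_self_removeNth r y).symm⟩

theorem ncard_support_eq_slices {n : ℕ} (r : Fin (n + 1)) (f : (Fin (n + 1) → ZMod 2) → ℝ) :
    (Function.support f).ncard
      = (Function.support (cubeSlice r 0 f)).ncard + (Function.support (cubeSlice r 1 f)).ncard := by
  have hinj : ∀ a : ZMod 2, Function.Injective
      (fun x : Fin n → ZMod 2 => (r.insertNth a x : Fin (n + 1) → ZMod 2)) :=
    fun a => Fin.insertNth_right_injective (α := fun _ => ZMod 2) (p := r) a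
  rw [← Set.ncard_image_of_injective _ (hinj 0), ← Set.ncard_image_of_injective _ (hinj 1),
    ← Set.ncard_union_eq]
  · congr 1
    ext y
    obtain ⟨a, x, rfl⟩ := exists_insertNth r y
    simp only [Set.mem_union, Set.mem_image, Function.mem_support, Fin.insertNth_inj, cubeSlice]
    constructor
    · intro h
      obtain rfl | rfl := zmod_two_eq a
      · exact Or.inl ⟨x, h, rfl, rfl⟩
      · exact Or.inr ⟨x, h, rfl, rfl⟩
    · rintro (⟨z, hz, rfl, rfl⟩ | ⟨z, hz, rfl, rfl⟩) <;> exact hz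
  · rw [Set.disjoint_left]
    rintro _ ⟨z, -, rfl⟩ ⟨w, -, hw⟩
    have := congrFun hw r
    simp at this

/-! ### Lower bounds for the support and the parity twist -/

theorem ncard_support_sub_le {α : Type*} [Finite α] (f g : α → ℝ) :
    (Function.support (f - g)).ncard
      ≤ (Function.support f ∪ Function.support g).ncard :=
  Set.ncard_le_ncard (Function.support_sub f g) (Set.toFinite _)

/-- Taking `μ` real and producing `i` determines the spectrum in the same induction, so the slice
difference needs no separate check that its eigenvalue is admissible. -/
theorem IsCubeEigen.exists_pow_le_ncard_support {n : ℕ} :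
    ∀ {μ : ℝ} {f : (Fin n → ZMod 2) → ℝ}, IsCubeEigen n μ f → f ≠ 0 →
      ∃ i : ℕ, i ≤ n ∧ μ = n - 2 * i ∧ 2 ^ (n - i) ≤ (Function.support f).ncard := by
  induction n with
  | zero =>
    intro μ f hf hne
    obtain ⟨x, hx⟩ := Function.ne_iff.1 hne
    have h := hf x
    simp only [Finset.univ_eq_empty, Finset.sum_empty, mul_eq_zero] at h
    refine ⟨0, le_rfl, by simpa using h.resolve_right hx, ?_⟩
    exact (Set.ncard_pos).2 ⟨x, hx⟩
  | succ n ih =>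
    intro μ f hf hne
    by_cases h : cubeSlice 0 0 f = cubeSlice 0 1 f
    · have hs := hf.slice_of_eq 0 h
      have hc := ncard_support_eq_slices 0 f
      rw [← h] at hc
      obtain ⟨i, hi, hμ, hle⟩ := ih hs (by
        rintro h0
        have : (Function.support f).ncard = 0 := by simp [hc, h0]
        rw [Set.ncard_eq_zero] at this
        exact hne (Function.support_eq_empty_iff.1 this))
      refine ⟨i, by omega, by push_cast; linarith, ?_⟩
      rw [hc, Nat.succ_sub hi, pow_succ]
      omega
    · obtain ⟨i, hi, hμ, hle⟩ := ih (hf.slice_sub 0) (sub_ne_zero.2 h)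
      refine ⟨i + 1, by omega, by push_cast; linarith, ?_⟩
      rw [Nat.add_sub_add_right, ncard_support_eq_slices 0 f]
      exact hle.trans ((ncard_support_sub_le _ _).trans (Set.ncard_union_le _ _))

/-- The nontrivial character of `ℤ₂`. -/
def signChar (a : ZMod 2) : ℝ := if a = 0 then 1 else -1

theorem signChar_add (a b : ZMod 2) : signChar (a + b) = signChar a * signChar b := by
  rcases zmod_two_eq a with rfl | rfl <;> rcases zmod_two_eq b with rfl | rfl <;>
    simp [signChar, show (1 : ZMod 2) + 1 = 0 from rfl]

theorem signChar_ne_zero (a : ZMod 2) : signChar a ≠ 0 := by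
  unfold signChar; split_ifs <;> norm_num

theorem signChar_mul_self (a : ZMod 2) : signChar a * signChar a = 1 := by
  unfold signChar; split_ifs <;> norm_num

/-- The parity character `x ↦ (-1)^{|x|}` of `ℤ₂ⁿ`. -/
def cubeSign {n : ℕ} (x : Fin n → ZMod 2) : ℝ := ∏ j, signChar (x j)

theorem cubeSign_add {n : ℕ} (x y : Fin n → ZMod 2) :
    cubeSign (x + y) = cubeSign x * cubeSign y := by
  simp [cubeSign, signChar_add, Finset.prod_mul_distrib]

theorem cubeSign_ne_zero {n : ℕ} (x : Fin n → ZMod 2) : cubeSign x ≠ 0 :=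
  Finset.prod_ne_zero_iff.2 fun _ _ => signChar_ne_zero _

theorem cubeSign_mul_self {n : ℕ} (x : Fin n → ZMod 2) : cubeSign x * cubeSign x = 1 := by
  simp [cubeSign, ← Finset.prod_mul_distrib, signChar_mul_self]

theorem cubeSign_single {n : ℕ} (j : Fin n) : cubeSign (Pi.single j (1 : ZMod 2)) = -1 := by
  rw [cubeSign, Finset.prod_eq_single j]
  · simp [signChar]
  · intro k _ hk
    simp [hk, signChar]
  · simp

theorem IsCubeEigen.cubeSign_mul {n : ℕ} {μ : ℝ} {f : (Fin n → ZMod 2) → ℝ}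
    (hf : IsCubeEigen n μ f) : IsCubeEigen n (-μ) (cubeSign * f) := by
  intro x
  have h := hf x
  simp only [Pi.mul_apply, cubeSign_add, cubeSign_single, mul_neg,
    ← Finset.mul_sum, ← h]
  ring

theorem support_cubeSign_mul {n : ℕ} (f : (Fin n → ZMod 2) → ℝ) :
    Function.support (cubeSign * f) = Function.support f := by
  ext x
  simp [cubeSign_ne_zero]

theorem IsCubeEigen.pow_le_ncard_support {n i : ℕ} {f : (Fin n → ZMod 2) → ℝ}
    (hf : IsCubeEigen n (n - 2 * i) f) (hne : f ≠ 0) :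
    2 ^ i ≤ (Function.support f).ncard := by
  have hne' : cubeSign * f ≠ 0 := by
    rw [← Function.support_nonempty_iff, support_cubeSign_mul]
    exact Function.support_nonempty_iff.2 hne
  obtain ⟨j, hj, hμ, h⟩ := hf.cubeSign_mul.exists_pow_le_ncard_support hne'
  have : ((n - j : ℕ) : ℝ) = i := by rw [Nat.cast_sub hj]; linarith
  rw [Nat.cast_inj] at this
  rwa [this, support_cubeSign_mul] at h

/-! ### Eigenfunctions of minimum support -/

/-- An eigenfunction of minimum support that is not symmetric in the coordinate `r` has disjoint
supports on the two subcubes `x_r = 0` and `x_r = 1`, and the difference of its two slices has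
minimum support as well. -/
theorem IsCubeEigen.slice_disjoint {n i : ℕ} {f : (Fin (n + 1) → ZMod 2) → ℝ}
    (hf : IsCubeEigen (n + 1) ((n + 1 : ℕ) - 2 * i) f)
    (hc : (Function.support f).ncard = 2 ^ (n + 1 - i)) {r : Fin (n + 1)}
    (h : cubeSlice r 0 f ≠ cubeSlice r 1 f) :
    Disjoint (Function.support (cubeSlice r 0 f)) (Function.support (cubeSlice r 1 f)) ∧
      (Function.support (cubeSlice r 0 f - cubeSlice r 1 f)).ncard = 2 ^ (n + 1 - i) := by
  obtain ⟨j, hj, hμ, hle⟩ :=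
    (hf.slice_sub r).exists_pow_le_ncard_support (sub_ne_zero.2 h)
  have hij : i = j + 1 := by
    push_cast at hμ
    have : (i : ℝ) = (j + 1 : ℕ) := by push_cast; linarith
    exact_mod_cast this
  subst hij
  rw [Nat.add_sub_add_right] at hc ⊢
  rw [ncard_support_eq_slices r f] at hc
  -- The union of the two supports has at least `2 ^ (n - j)` points, which is already the sum of
  -- their sizes, so nothing is left for the intersection.
  have h1 := ncard_support_sub_le (cubeSlice r 0 f) (cubeSlice r 1 f)
  have h2 := Set.ncard_union_add_ncard_inter (Function.support (cubeSlice r 0 f))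
    (Function.support (cubeSlice r 1 f))
  refine ⟨?_, by omega⟩
  rw [Set.disjoint_iff_inter_eq_empty, ← Set.ncard_eq_zero]
  omega

theorem cubeSlice_eq_zero_of_ne {n : ℕ} {f : (Fin (n + 1) → ZMod 2) → ℝ} {r : Fin (n + 1)}
    (h : Disjoint (Function.support (cubeSlice r 0 f)) (Function.support (cubeSlice r 1 f)))
    {a : ZMod 2} {x : Fin n → ZMod 2} (hx : cubeSlice r a f x ≠ 0) :
    cubeSlice r (a + 1) f x = 0 := by
  obtain rfl | rfl := zmod_two_eq a
  · by_contra hne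
    exact Set.disjoint_left.1 h hx hne
  · by_contra hne
    exact Set.disjoint_left.1 h (show x ∈ Function.support (cubeSlice r 0 f) from hne) hx

theorem ne_zero_of_ncard_support_eq_pow {α : Type*} {f : α → ℝ} {m : ℕ}
    (hc : (Function.support f).ncard = 2 ^ m) : f ≠ 0 := by
  rintro rfl
  have : 0 < 2 ^ m := by positivity
  simp [← hc] at this

/-- The support of an eigenfunction of minimum support that is symmetric in no coordinate is an
independent set. -/
theorem IsCubeEigen.eq_zero_of_adj {n i : ℕ} {f : (Fin (n + 1) → ZMod 2) → ℝ}
    (hf : IsCubeEigen (n + 1) ((n + 1 : ℕ) - 2 * i) f)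
    (hc : (Function.support f).ncard = 2 ^ (n + 1 - i))
    (hs : ∀ r, cubeSlice r 0 f ≠ cubeSlice r 1 f) {x : Fin (n + 1) → ZMod 2} (hx : f x ≠ 0)
    (j : Fin (n + 1)) : f (x + Pi.single j 1) = 0 := by
  have hd := (hf.slice_disjoint hc (hs j)).1
  obtain ⟨a, z, rfl⟩ := exists_insertNth j x
  rw [insertNth_add_single_self]
  exact cubeSlice_eq_zero_of_ne hd hx

/-- An eigenfunction of minimum support is symmetric in some coordinate, or belongs to the
eigenvalue `0`. -/
theorem IsCubeEigen.exists_slice_eq_or {n i : ℕ} {f : (Fin (n + 1) → ZMod 2) → ℝ}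
    (hf : IsCubeEigen (n + 1) ((n + 1 : ℕ) - 2 * i) f)
    (hc : (Function.support f).ncard = 2 ^ (n + 1 - i)) :
    (∃ r, cubeSlice r 0 f = cubeSlice r 1 f) ∨ n + 1 = 2 * i := by
  by_contra! hcon
  obtain ⟨hs, hn⟩ := hcon
  obtain ⟨x, hx⟩ := Function.ne_iff.1 (ne_zero_of_ncard_support_eq_pow hc)
  have h := (hf x).trans (Finset.sum_eq_zero fun j _ => hf.eq_zero_of_adj hc hs hx j)
  rcases mul_eq_zero.1 h with h | h
  · refine hn ?_
    have : ((n + 1 : ℕ) : ℝ) = (2 * i : ℕ) := by push_cast at h ⊢; linarith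
    exact_mod_cast this
  · exact hx h

/-! ### Splitting off copies of `φ₂` -/

/-- `f` is, up to a nonzero factor and a translation, the product of copies of `φ₂` evaluated at
`i` disjoint pairs of coordinates. -/
def IsPhiTwoProduct (n i : ℕ) (f : (Fin n → ZMod 2) → ℝ) : Prop :=
  ∃ c : ℝ, c ≠ 0 ∧ ∃ p : Fin i × Fin 2 → Fin n, Function.Injective p ∧ ∃ a : Fin n → ZMod 2,
    ∀ x, f x = c * ∏ k, phiFun 2 (fun b => x (p (k, b)) + a (p (k, b)))

theorem IsPhiTwoProduct.of_slice {n i : ℕ} {f : (Fin (n + 1) → ZMod 2) → ℝ} {r : Fin (n + 1)}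
    (h : cubeSlice r 0 f = cubeSlice r 1 f) (hs : IsPhiTwoProduct n i (cubeSlice r 0 f)) :
    IsPhiTwoProduct (n + 1) i f := by
  obtain ⟨c, hc, p, hp, a, hf⟩ := hs
  refine ⟨c, hc, r.succAbove ∘ p, Fin.succAbove_right_injective.comp hp, r.insertNth 0 a, ?_⟩
  intro y
  obtain ⟨b, x, rfl⟩ := exists_insertNth r y
  have hb : f (r.insertNth b x) = cubeSlice r 0 f x := by
    obtain rfl | rfl := zmod_two_eq b
    · rfl
    · rw [h]; rfl
  rw [hb, hf]
  simp

theorem isPhiTwoProduct_zero {f : (Fin 0 → ZMod 2) → ℝ} (h : f ≠ 0) : IsPhiTwoProduct 0 0 f := by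
  obtain ⟨x, hx⟩ := Function.ne_iff.1 h
  refine ⟨f x, hx, fun q => q.1.elim0, fun q => q.1.elim0, 0, fun y => ?_⟩
  simp [Subsingleton.elim y x]

/-- The tensor product of `φ₂`, translated by `(0, t)` and placed on two new coordinates, with a
product of copies of `φ₂`. -/
theorem IsPhiTwoProduct.of_double_slice {n i : ℕ} {f : (Fin (n + 2) → ZMod 2) → ℝ}
    {g : (Fin n → ZMod 2) → ℝ} (s : Fin (n + 1)) (t : ZMod 2)
    (h : ∀ (α β : ZMod 2) (x : Fin n → ZMod 2),
      cubeSlice s β (cubeSlice 0 α f) x = phiFun 2 ![α, β + t] * g x)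
    (hg : IsPhiTwoProduct n i g) : IsPhiTwoProduct (n + 2) (i + 1) f := by
  obtain ⟨c, hc, p, hp, a, hf⟩ := hg
  let q : Fin (i + 1) → Fin 2 → Fin (n + 2) :=
    Fin.cons ![0, s.succ] fun k b => (s.succAbove (p (k, b))).succ
  refine ⟨c, hc, fun kb => q kb.1 kb.2, ?_, Fin.cons 0 (s.insertNth t a : Fin (n + 1) → ZMod 2), ?_⟩
  · have h0 : Function.Injective (q 0) := by
      have : (0 : Fin (n + 2)) ≠ s.succ := (Fin.succ_ne_zero s).symm
      intro b b'
      fin_cases b <;> fin_cases b' <;> simp [q, this, this.symm]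
    have hne : ∀ b k b', q 0 b ≠ q (Fin.succ k) b' := by
      intro b k b'
      fin_cases b
      · exact (Fin.succ_ne_zero _).symm
      · exact fun h => Fin.succAbove_ne s _ (Fin.succ_injective _ h).symm
    rintro ⟨k, b⟩ ⟨k', b'⟩ hkk
    simp only at hkk
    induction k using Fin.cases with
    | zero =>
      induction k' using Fin.cases with
      | zero => rw [h0 hkk]
      | succ k' => exact (hne _ _ _ hkk).elim
    | succ k =>
      induction k' using Fin.cases with
      | zero => exact (hne _ _ _ hkk.symm).elim
      | succ k' =>
        have h : (k, b) = (k', b') :=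
          hp (Fin.succAbove_right_injective (Fin.succ_injective _ hkk))
        obtain ⟨rfl, rfl⟩ := Prod.mk.inj h
        rfl
  · intro y
    obtain ⟨α, y', rfl⟩ : ∃ α y', y = Fin.cons α y' := ⟨y 0, Fin.tail y, (Fin.cons_self_tail y).symm⟩
    obtain ⟨β, x, rfl⟩ := exists_insertNth s y'
    have h' := h α β x
    rw [cubeSlice, cubeSlice, Fin.insertNth_zero'] at h'
    rw [h', hf, Fin.prod_univ_succ]
    have e : (fun b : Fin 2 =>
        (Fin.cons α (s.insertNth β x : Fin (n + 1) → ZMod 2) : Fin (n + 2) → ZMod 2) (q 0 b) +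
        (Fin.cons 0 (s.insertNth t a : Fin (n + 1) → ZMod 2) : Fin (n + 2) → ZMod 2) (q 0 b))
        = ![α, β + t] := by
      funext b
      fin_cases b <;> simp [q]
    rw [e]
    simp only [q, Fin.cons_succ, Fin.insertNth_apply_succAbove]
    ring

theorem phiFun_two_apply (a b : ZMod 2) :
    phiFun 2 ![a, b] = if a = b then signChar a else 0 := by
  rcases zmod_two_eq a with rfl | rfl <;> rcases zmod_two_eq b with rfl | rfl <;>
    simp [phiFun, signChar, funext_iff, Fin.forall_fin_two]

theorem isPhiTwoProduct_of_ncard_support (n : ℕ) : ∀ (i : ℕ) (f : (Fin n → ZMod 2) → ℝ),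
    2 * i ≤ n → IsCubeEigen n (n - 2 * i) f → (Function.support f).ncard = 2 ^ (n - i) →
      IsPhiTwoProduct n i f := by
  induction n using Nat.strong_induction_on with
  | _ n ih =>
  intro i f hi hf hc
  rcases n with _ | n
  · obtain rfl : i = 0 := by omega
    exact isPhiTwoProduct_zero (ne_zero_of_ncard_support_eq_pow hc)
  by_cases hsym : ∃ r, cubeSlice r 0 f = cubeSlice r 1 f
  · obtain ⟨r, hr⟩ := hsym
    have hs : IsCubeEigen n (n - 2 * i) (cubeSlice r 0 f) := by
      have := hf.slice_of_eq r hr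
      push_cast at this
      convert this using 1
      ring
    have hcs := ncard_support_eq_slices r f
    rw [← hr, hc, Nat.succ_sub (by omega), pow_succ] at hcs
    have hcs' : (Function.support (cubeSlice r 0 f)).ncard = 2 ^ (n - i) := by omega
    -- The other bound gives `2 ^ i ≤ 2 ^ (n - i)`, hence `2 * i ≤ n`, as the induction hypothesis
    -- requires in the smaller dimension.
    have hle := hs.pow_le_ncard_support (ne_zero_of_ncard_support_eq_pow hcs')
    rw [hcs', Nat.pow_le_pow_iff_right (by norm_num)] at hle
    exact .of_slice hr (ih n (by omega) i _ (by omega) hs hcs')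
  · have hn := (hf.exists_slice_eq_or hc).resolve_left hsym
    push Not at hsym
    obtain ⟨j, rfl⟩ : ∃ j, i = j + 1 := ⟨i - 1, by omega⟩
    obtain rfl : n = 2 * j + 1 := by omega
    have hd := hf.slice_disjoint hc (hsym 0)
    have hg : IsCubeEigen (2 * j + 1) ((2 * j + 1 : ℕ) - 2 * j)
        (cubeSlice 0 0 f - cubeSlice 0 1 f) := by
      convert hf.slice_sub 0 using 1
      push_cast
      ring
    -- The difference lives in odd dimension `2 * j + 1`, so its eigenvalue is not `0`.
    obtain ⟨s, hs⟩ := (hg.exists_slice_eq_or (by rw [hd.2]; congr 1; omega)).resolve_right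
      (by omega)
    let F : ZMod 2 → ZMod 2 → (Fin (2 * j) → ZMod 2) → ℝ := fun α β =>
      cubeSlice s β (cubeSlice 0 α f)
    have hadj0 : ∀ α β x, F α β x ≠ 0 → F (α + 1) β x = 0 := by
      intro α β x h
      have := hf.eq_zero_of_adj hc hsym h 0
      rwa [insertNth_add_single_self] at this
    have hadj1 : ∀ α β x, F α β x ≠ 0 → F α (β + 1) x = 0 := by
      intro α β x h
      have := hf.eq_zero_of_adj hc hsym h (Fin.succAbove 0 s)
      rwa [insertNth_add_single_succAbove, insertNth_add_single_self] at this
    have hsx : ∀ x, F 0 0 x - F 1 0 x = F 0 1 x - F 1 1 x := fun x => congrFun hs x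
    have e0 : (0 : ZMod 2) + 1 = 1 := rfl
    have e1 : (1 : ZMod 2) + 1 = 0 := rfl
    -- The four values sit on a 4-cycle. By `hsx` both pairs of opposite corners have the same sum;
    -- by independence one pair vanishes, so both sums are `0`.
    have key : ∀ x, F 1 1 x = - F 0 0 x ∧ F 1 0 x = - F 0 1 x := by
      intro x
      have a1 := hadj0 0 0 x
      have a2 := hadj0 0 1 x
      have b1 := hadj1 0 0 x
      have b2 := hadj1 1 0 x
      have h := hsx x
      rw [e0] at a1 a2 b1 b2
      by_cases h00 : F 0 0 x = 0
      · by_cases h01 : F 0 1 x = 0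
        · rw [h00, h01] at h
          by_cases h10 : F 1 0 x = 0
          · exact ⟨by linarith, by linarith⟩
          · have := b2 h10
            exact ⟨by linarith, by linarith⟩
        · have := a2 h01
          exact ⟨by linarith, by linarith⟩
      · have := a1 h00
        have := b1 h00
        exact ⟨by linarith, by linarith⟩
    have k11 : F 1 1 = - F 0 0 := funext fun x => (key x).1
    have k10 : F 1 0 = - F 0 1 := funext fun x => (key x).2
    -- The two neighbours outside the slice are opposite corners, so their values cancel.
    have hE : ∀ β, IsCubeEigen (2 * j) ((2 * j : ℕ) - 2 * j) (F 0 β) := by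
      intro β x
      have h : _ = F (0 + 1) β x + (F 0 (β + 1) x + _) := hf.slice_slice 0 s 0 β x
      have h0 : F (0 + 1) β x + F 0 (β + 1) x = 0 := by
        rcases zmod_two_eq β with rfl | rfl
        · rw [e0, k10]; simp
        · rw [e0, e1, k11]; simp
      push_cast at h ⊢
      linear_combination h + h0
    have hcard : (Function.support (F 0 0)).ncard + (Function.support (F 0 1)).ncard = 2 ^ j := by
      have h1 := ncard_support_eq_slices 0 f
      rw [ncard_support_eq_slices s (cubeSlice 0 0 f), ncard_support_eq_slices s (cubeSlice 0 1 f),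
        hc] at h1
      change _ = (Function.support (F 0 0)).ncard + (Function.support (F 0 1)).ncard
        + ((Function.support (F 1 0)).ncard + (Function.support (F 1 1)).ncard) at h1
      rw [k11, k10, Function.support_neg, Function.support_neg,
        show 2 * j + 1 + 1 - (j + 1) = j + 1 by omega, pow_succ] at h1
      omega
    have hmin : ∀ β, F 0 β ≠ 0 → 2 ^ j ≤ (Function.support (F 0 β)).ncard :=
      fun β h => (hE β).pow_le_ncard_support h
    have hpos : 0 < 2 ^ j := by positivity
    have hIH : ∀ β, (Function.support (F 0 β)).ncard = 2 ^ j →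
        IsPhiTwoProduct (2 * j) j (F 0 β) := fun β h =>
      ih (2 * j) (by omega) j _ le_rfl (hE β) (by rw [h]; congr 1; omega)
    -- The supports of `F 0 0` and `F 0 1` total `2 ^ j`, the minimum for either if nonzero, so
    -- exactly one survives. It decides whether `φ₂` sits on `α ≠ β` (translation `1`) or on `α =
    -- β`.
    by_cases h0 : F 0 0 = 0
    · refine .of_double_slice s 1 ?_ (hIH 1 (by simpa [h0] using hcard))
      intro α β x
      rw [phiFun_two_apply]
      change F α β x = _
      rcases zmod_two_eq α with rfl | rfl <;> rcases zmod_two_eq β with rfl | rfl <;>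
        simp [signChar, h0, k11, k10, e1]
    · have h1 : F 0 1 = 0 := by
        by_contra h1
        have := hmin 0 h0
        have := hmin 1 h1
        omega
      refine .of_double_slice s 0 ?_ (hIH 0 (by simpa [h1] using hcard))
      intro α β x
      rw [phiFun_two_apply]
      change F α β x = _
      rcases zmod_two_eq α with rfl | rfl <;> rcases zmod_two_eq β with rfl | rfl <;>
        simp [signChar, h1, k11, k10]

/-! ### Automorphisms and coordinate formulas for the tensor products -/

/-- Translations combined with permutations of the coordinates act on the hypercube by
automorphisms. -/
def hypercubeAffineIso {n : ℕ} (σ : Equiv.Perm (Fin n)) (a : Fin n → ZMod 2) :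
    hypercube n ≃g hypercube n where
  toEquiv := (σ.arrowCongr (Equiv.refl (ZMod 2))).trans (Equiv.addRight a)
  map_rel_iff' := by
    intro x y
    change hammingDist (fun j => x (σ.symm j) + a j) (fun j => y (σ.symm j) + a j) = 1 ↔
      hammingDist x y = 1
    have : hammingDist (fun j => x (σ.symm j) + a j) (fun j => y (σ.symm j) + a j)
        = hammingDist x y :=
      Finset.card_equiv σ.symm (by simp)
    rw [this]

theorem hypercubeAffineIso_apply {n : ℕ} (σ : Equiv.Perm (Fin n)) (a x : Fin n → ZMod 2) :
    hypercubeAffineIso σ a x = (fun j => x (σ.symm j)) + a := rfl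

theorem cubeSign_hypercubeAffineIso {n : ℕ} (σ : Equiv.Perm (Fin n)) (a x : Fin n → ZMod 2) :
    cubeSign (hypercubeAffineIso σ a x) = cubeSign x * cubeSign a := by
  rw [hypercubeAffineIso_apply, cubeSign_add]
  congr 1
  exact Equiv.prod_comp σ.symm fun j => signChar (x j)

theorem exists_perm_apply_eq {α β : Type*} [Fintype α] [DecidableEq α] {p q : β → α}
    (hp : Function.Injective p) (hq : Function.Injective q) :
    ∃ σ : Equiv.Perm α, ∀ b, σ (q b) = p b := by
  classical
  let e : {x // x ∈ Set.range q} ≃ {x // x ∈ Set.range p} :=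
    (Equiv.ofInjective q hq).symm.trans (Equiv.ofInjective p hp)
  refine ⟨e.extendSubtype, fun b => ?_⟩
  rw [e.extendSubtype_apply_of_mem (q b) ⟨b, rfl⟩]
  have : (Equiv.ofInjective q hq).symm ⟨q b, b, rfl⟩ = b :=
    (Equiv.ofInjective q hq).symm_apply_eq.2 rfl
  simp [e, this]

theorem IsPhiTwoProduct.exists_affineIso {n i : ℕ} {f : (Fin n → ZMod 2) → ℝ}
    (hf : IsPhiTwoProduct n i f) {q : Fin i × Fin 2 → Fin n} (hq : Function.Injective q) :
    ∃ σ a, ∃ c : ℝ, c ≠ 0 ∧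
      ∀ x, ∏ k, phiFun 2 (fun b => x (q (k, b))) = c * f (hypercubeAffineIso σ a x) := by
  obtain ⟨c, hc, p, hp, a, hf⟩ := hf
  obtain ⟨σ, hσ⟩ := exists_perm_apply_eq hp hq
  refine ⟨σ, a, c⁻¹, inv_ne_zero hc, fun x => ?_⟩
  -- In characteristic two, translating by `a` undoes the translation in `IsPhiTwoProduct`.
  have h2 : ∀ u v : ZMod 2, u + v + v = u := by decide
  simp only [hf, hypercubeAffineIso_apply, Pi.add_apply, ← hσ, Equiv.symm_apply_apply, h2]
  rw [inv_mul_cancel_left₀ hc]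

theorem tensorPow_apply {m : ℕ} (f : (Fin m → ZMod 2) → ℝ) (k : ℕ) (z : Fin (m * k) → ZMod 2) :
    tensorPow f k z
      = ∏ j : Fin k, f fun b => z (Fin.cast (mul_comm k m) (finProdFinEquiv (j, b))) := by
  induction k with
  | zero => simp [tensorPow]
  | succ k ih =>
    rw [tensorPow, tensorFun, ih, Fin.prod_univ_castSucc]
    congr 1
    congr 1
    funext b
    congr 1
    ext
    simp [finProdFinEquiv, add_comm]

theorem cubeSign_eq_mul {m n : ℕ} (z : Fin (m + n) → ZMod 2) :
    cubeSign z = cubeSign (fun a => z (Fin.castAdd n a)) * cubeSign (fun b => z (Fin.natAdd m b)) :=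
  Fin.prod_univ_add _

theorem psiFun_one (x : Fin 1 → ZMod 2) : psiFun 1 x = 1 := by
  rcases zmod_two_eq (x 0) with h | h <;> simp [psiFun, funext_iff, h]

theorem phiFun_one (x : Fin 1 → ZMod 2) : phiFun 1 x = cubeSign x := by
  rcases zmod_two_eq (x 0) with h | h <;> simp [phiFun, cubeSign, signChar, funext_iff, h]

/-- `φ₂` lives on vectors of even weight. The parity twist therefore changes only the factors `ψ₁`,
turning them into `φ₁`. -/
theorem cubeSign_mul_phiFun_two (x : Fin 2 → ZMod 2) : cubeSign x * phiFun 2 x = phiFun 2 x := by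
  rcases zmod_two_eq (x 0) with h | h <;> rcases zmod_two_eq (x 1) with h' | h' <;>
    simp [phiFun, cubeSign, signChar, funext_iff, Fin.forall_fin_two, h, h']

theorem tensorPow_psiFun_one (k : ℕ) (z : Fin (1 * k) → ZMod 2) : tensorPow (psiFun 1) k z = 1 := by
  simp [tensorPow_apply, psiFun_one]

theorem tensorPow_phiFun_one (k : ℕ) : tensorPow (phiFun 1) k = cubeSign := by
  induction k with
  | zero => funext z; simp [tensorPow, cubeSign]
  | succ k ih =>
    funext z
    rw [tensorPow, tensorFun, ih, phiFun_one]
    exact (cubeSign_eq_mul (m := 1 * k) (n := 1) z).symm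

theorem cubeSign_mul_tensorPow_phiFun_two (k : ℕ) (z : Fin (2 * k) → ZMod 2) :
    cubeSign z * tensorPow (phiFun 2) k z = tensorPow (phiFun 2) k z := by
  induction k with
  | zero => simp [tensorPow, cubeSign]
  | succ k ih =>
    rw [tensorPow, tensorFun, cubeSign_eq_mul (m := 2 * k) (n := 2) z, mul_mul_mul_comm]
    exact congrArg₂ (· * ·) (ih _) (cubeSign_mul_phiFun_two _)

/-- The position in `Fin n` of the `b`-th variable of the `k`-th factor `φ₂`. -/
def phiTwoPosition {m i n : ℕ} (h : 1 * m + 2 * i = n) (q : Fin i × Fin 2) : Fin n :=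
  Fin.cast h (Fin.natAdd (1 * m) (Fin.cast (mul_comm i 2) (finProdFinEquiv q)))

theorem phiTwoPosition_injective {m i n : ℕ} (h : 1 * m + 2 * i = n) :
    Function.Injective (phiTwoPosition h) :=
  (Fin.cast_injective h).comp <| (Fin.natAdd_injective _ _).comp <|
    (Fin.cast_injective _).comp finProdFinEquiv.injective

theorem castDim_psi_phi_apply {m i n : ℕ} (h : 1 * m + 2 * i = n) (x : Fin n → ZMod 2) :
    castDim h (tensorFun (tensorPow (psiFun 1) m) (tensorPow (phiFun 2) i)) x
      = ∏ k, phiFun 2 fun b => x (phiTwoPosition h (k, b)) := by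
  rw [castDim, tensorFun, tensorPow_psiFun_one, one_mul, tensorPow_apply]
  rfl

theorem castDim_phi_phi_apply {m i n : ℕ} (h : 1 * m + 2 * i = n) (x : Fin n → ZMod 2) :
    castDim h (tensorFun (tensorPow (phiFun 1) m) (tensorPow (phiFun 2) i)) x
      = cubeSign x * ∏ k, phiFun 2 fun b => x (phiTwoPosition h (k, b)) := by
  rw [← castDim_psi_phi_apply]
  subst h
  rw [castDim, castDim, tensorFun, tensorFun, tensorPow_psiFun_one, tensorPow_phiFun_one,
    one_mul (_ : ℝ), cubeSign_eq_mul x, mul_assoc]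
  congr 1
  exact (cubeSign_mul_tensorPow_phiFun_two i _).symm

/-! ### Support sizes of the model functions -/

theorem ncard_support_tensorFun {m n : ℕ} (f : (Fin m → ZMod 2) → ℝ) (g : (Fin n → ZMod 2) → ℝ) :
    (Function.support (tensorFun f g)).ncard
      = (Function.support f).ncard * (Function.support g).ncard := by
  rw [← Set.ncard_prod, ← Set.ncard_image_of_injective _ (Fin.appendEquiv m n).injective]
  congr 1
  ext z
  rw [Equiv.image_eq_preimage_symm]
  simp [tensorFun, Fin.appendEquiv]

theorem ncard_support_tensorPow {m : ℕ} (f : (Fin m → ZMod 2) → ℝ) (k : ℕ) :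
    (Function.support (tensorPow f k)).ncard = (Function.support f).ncard ^ k := by
  induction k with
  | zero =>
    have : Function.support (tensorPow f 0) = Set.univ := by ext; simp [tensorPow]
    rw [this, Set.ncard_univ, pow_zero, Nat.card_eq_one_iff_unique]
    exact ⟨⟨fun x y => funext fun j => j.elim0⟩, ⟨fun j => j.elim0⟩⟩
  | succ k ih => rw [tensorPow, ncard_support_tensorFun, ih, pow_succ]

theorem ncard_support_castDim {m n : ℕ} (h : m = n) (f : (Fin m → ZMod 2) → ℝ) :
    (Function.support (castDim h f)).ncard = (Function.support f).ncard := by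
  subst h
  rfl

theorem ncard_support_phiFun {k : ℕ} (hk : 0 < k) : (Function.support (phiFun k)).ncard = 2 := by
  have : Nonempty (Fin k) := ⟨⟨0, hk⟩⟩
  have h : Function.support (phiFun k) = {0, 1} := by
    ext x
    by_cases h0 : x = 0 <;> by_cases h1 : x = 1 <;> simp [phiFun, h0, h1]
  rw [h, Set.ncard_pair zero_ne_one]

theorem ncard_support_psiFun {k : ℕ} (hk : 0 < k) : (Function.support (psiFun k)).ncard = 2 := by
  have : Nonempty (Fin k) := ⟨⟨0, hk⟩⟩
  have h : Function.support (psiFun k) = {0, 1} := by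
    ext x
    by_cases h0 : x = 0 <;> by_cases h1 : x = 1 <;> simp [psiFun, h0, h1]
  rw [h, Set.ncard_pair zero_ne_one]

theorem HypercubeEquivalent.ncard_support_eq {n : ℕ} {f g : (Fin n → ZMod 2) → ℝ}
    (h : HypercubeEquivalent f g) :
    (Function.support f).ncard = (Function.support g).ncard := by
  obtain ⟨π, c, hc, hg⟩ := h
  have : Function.support f = π.toEquiv '' Function.support g := by
    ext y
    rw [Equiv.image_eq_preimage_symm]
    simp only [Function.mem_support, Set.mem_preimage, hg]
    have : π (π.toEquiv.symm y) = y := π.toEquiv.apply_symm_apply y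
    simp [this, hc]
  rw [this, Set.ncard_image_of_injective _ π.toEquiv.injective]

/-! ### The characterization -/

theorem mainTheorem2 (n i : ℕ) (hi : i ≤ n) (f : (Fin n → ZMod 2) → ℝ)
    (hf : f ∈ hypercubeEigenspace n i) :
    (∀ h : n ≤ 2 * i,
      ((Function.support f).ncard = 2 ^ i ↔
        HypercubeEquivalent f
          (castDim (show 1 * (2 * i - n) + 2 * (n - i) = n by omega)
            (tensorFun (tensorPow (phiFun 1) (2 * i - n)) (tensorPow (phiFun 2) (n - i)))))) ∧
    (∀ h : 2 * i ≤ n,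
      ((Function.support f).ncard = 2 ^ (n - i) ↔
        HypercubeEquivalent f
          (castDim (show 1 * (n - 2 * i) + 2 * i = n by omega)
            (tensorFun (tensorPow (psiFun 1) (n - 2 * i)) (tensorPow (phiFun 2) i))))) := by
  rw [mem_hypercubeEigenspace_iff_isCubeEigen] at hf
  refine ⟨fun h => ⟨fun hc => ?_, fun he => ?_⟩, fun h => ⟨fun hc => ?_, fun he => ?_⟩⟩
  · have hf' : IsCubeEigen n (n - 2 * (n - i : ℕ)) (cubeSign * f) := by
      convert hf.cubeSign_mul using 1
      rw [Nat.cast_sub hi]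
      ring
    have hp := isPhiTwoProduct_of_ncard_support n (n - i) _ (by omega) hf'
      (by rw [support_cubeSign_mul, hc]; congr 1; omega)
    have hn : 1 * (2 * i - n) + 2 * (n - i) = n := by omega
    obtain ⟨σ, a, c, hc, hx⟩ := hp.exists_affineIso (phiTwoPosition_injective hn)
    -- Undoing the twist: the parity character is permutation invariant, and translation by `a` only
    -- multiplies it by `cubeSign a`, absorbed in the constant.
    refine ⟨hypercubeAffineIso σ a, c * cubeSign a, mul_ne_zero hc (cubeSign_ne_zero a),
      fun x => ?_⟩
    rw [castDim_phi_phi_apply, hx, Pi.mul_apply, cubeSign_hypercubeAffineIso]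
    linear_combination c * cubeSign a * f (hypercubeAffineIso σ a x) * cubeSign_mul_self x
  · rw [he.ncard_support_eq, ncard_support_castDim, ncard_support_tensorFun,
      ncard_support_tensorPow, ncard_support_tensorPow, ncard_support_phiFun one_pos,
      ncard_support_phiFun two_pos, ← pow_add]
    congr 1
    omega
  · have hp := isPhiTwoProduct_of_ncard_support n i f h hf hc
    have hn : 1 * (n - 2 * i) + 2 * i = n := by omega
    obtain ⟨σ, a, c, hc, hx⟩ := hp.exists_affineIso (phiTwoPosition_injective hn)
    exact ⟨hypercubeAffineIso σ a, c, hc, fun x => by rw [castDim_psi_phi_apply, hx]⟩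
  · rw [he.ncard_support_eq, ncard_support_castDim, ncard_support_tensorFun,
      ncard_support_tensorPow, ncard_support_tensorPow, ncard_support_psiFun one_pos,
      ncard_support_phiFun two_pos, ← pow_add]
    congr 1
    omega
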